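/- Let $X$ be a measurable space, i.e. a set with a $\sigma$-algebra $\mathcal{O}(X)$, and let $\mathcal{H}$ be a separable complex Hilbert space. A POVM on $X$ is a map $\mu:\mathcal{O}(X)\to\mathcal{B}(\mathcal{H})$ such that $\mu(A)\ge 0$ for all $A\in\mathcal{O}(X)$ and such that $A\mapsto\langle h,\mu(A)k\rangle$ is a complex measure for all $h,k\in\mathcal{H}$. It is normalized if $\mu(X)=I_{\mathcal{H}}$, and spectral if it is normalized and $\mu(A)$ is an orthogonal projection for every $A\in\mathcal{O}(X)$. A set $A\in\mathcal{O}(X)$ is an atom for $\mu$ if $\mu(A)\ne 0$ and, for every $B\in\mathcal{O}(X)$ with $B\subseteq A$, either $\mu(B)=0$ or $\mu(B)=\mu(A)$; $\mu$ is atomic if every $A\in\mathcal{O}(X)$ with $\mu(A)\neq 0$ contains an atom. A normalized POVM $\mu$ is $C^*$-extreme if, whenever $\mu(\cdot)=\sum_{i=1}^n T_i^*\mu_i(\cdot)T_i$ with normalized POVMs $\mu_i:\mathcal{O}(X)\to\mathcal{B}(\mathcal{H})$ and invertible $T_i\in\mathcal{B}(\mathcal{H})$ satisfying $\sum_{i=1}^n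 T_i^*T_i=I_{\mathcal{H}}$, there are unitary operators $U_i$ on $\mathcal{H}$ with $\mu_i(\cdot)=U_i^*\mu(\cdot)U_i$ for $1\le i\le n$. Theorem. An atomic normalized POVM on $X$ with values in $\mathcal{B}(\mathcal{H})$ is $C^*$-extreme if and only if it is spectral. In particular, if $X$ is countable (finite or countably infinite), then every $C^*$-extreme normalized POVM on $X$ with values in $\mathcal{B}(\mathcal{H})$ is spectral. -/

import Mathlib

/-- A positive operator valued measure on the measurable space `X` with values in the bounded
operators on `H`: a map on the measurable sets (extended by `0` to all other sets, as for Mathlib's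
vector measures) with positive values such that every `A ↦ ⟪h, μ A k⟫` is a complex measure. -/
structure POVM (X : Type*) [MeasurableSpace X] (H : Type*) [NormedAddCommGroup H]
    [InnerProductSpace ℂ H] [CompleteSpace H] where
  /-- The underlying set function. -/
  toFun : Set X → (H →L[ℂ] H)
  not_measurable' : ∀ A : Set X, ¬ MeasurableSet A → toFun A = 0
  isPositive' : ∀ A : Set X, MeasurableSet A → (toFun A).IsPositive
  isComplexMeasure' : ∀ h k : H, ∃ ν : MeasureTheory.ComplexMeasure X,
    ∀ A : Set X, MeasurableSet A → ν A = inner ℂ h (toFun A k)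

namespace POVM

variable {X : Type*} [MeasurableSpace X] {H : Type*} [NormedAddCommGroup H]
  [InnerProductSpace ℂ H] [CompleteSpace H]

instance : CoeFun (POVM X H) (fun _ => Set X → (H →L[ℂ] H)) := ⟨POVM.toFun⟩

/-- `μ` is normalized if `μ(X)` is the identity operator. -/
def IsNormalized (μ : POVM X H) : Prop := μ Set.univ = 1

/-- `μ` is a projection valued measure if every `μ(A)` is an orthogonal projection. -/
def IsPVM (μ : POVM X H) : Prop := ∀ A : Set X, MeasurableSet A → IsStarProjection (μ A)

/-- `μ` is spectral if it is a normalized projection valued measure. -/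
def IsSpectral (μ : POVM X H) : Prop := μ.IsPVM ∧ μ.IsNormalized

/-- `A` is an atom for `μ`. -/
def IsAtomFor (μ : POVM X H) (A : Set X) : Prop :=
  MeasurableSet A ∧ μ A ≠ 0 ∧ ∀ B : Set X, MeasurableSet B → B ⊆ A → μ B = 0 ∨ μ B = μ A

/-- `μ` is atomic if every measurable set of nonzero measure contains an atom. -/
def IsAtomic (μ : POVM X H) : Prop :=
  ∀ A : Set X, MeasurableSet A → μ A ≠ 0 → ∃ B : Set X, B ⊆ A ∧ μ.IsAtomFor B

/-- `μ = ∑ i, T i ^* (ν i) (·) (T i)` is a proper C*-convex combination: the `ν i` are normalized,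
the coefficients `T i` are invertible and `∑ i, T i ^* T i = 1`. -/
def IsProperCStarCombination (μ : POVM X H) {n : ℕ} (ν : Fin n → POVM X H)
    (T : Fin n → (H →L[ℂ] H)) : Prop :=
  (∀ i, (ν i).IsNormalized) ∧ (∀ i, IsUnit (T i)) ∧ ∑ i, star (T i) * T i = 1 ∧
    ∀ A : Set X, MeasurableSet A → μ A = ∑ i, star (T i) * ν i A * T i

/-- `ν` is unitarily equivalent to `μ`: `ν(·) = U^* μ(·) U` for a unitary operator `U` on `H`. -/
def IsUnitarilyEquivalent (ν μ : POVM X H) : Prop :=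
  ∃ U ∈ unitary (H →L[ℂ] H), ∀ A : Set X, MeasurableSet A → ν A = star U * μ A * U

/-- `μ` is a C*-extreme point of the set of normalized POVMs: it is normalized, and whenever it is
written as a proper C*-convex combination of normalized POVMs `ν i`, each `ν i` is unitarily
equivalent to `μ`. -/
def IsCStarExtreme (μ : POVM X H) : Prop :=
  μ.IsNormalized ∧ ∀ (n : ℕ) (ν : Fin n → POVM X H) (T : Fin n → (H →L[ℂ] H)),
    μ.IsProperCStarCombination ν T → ∀ i, (ν i).IsUnitarilyEquivalent μ

end POVM

/-! Spectral implies extreme: if the projection `μ A` dominates `T^* ν(A) T` for all `A`, then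
applying this to `A` and `Aᶜ` yields `ν(A) T = T μ(A)`, and the unitary polar part of `T` carries
`μ` to `ν`.

Conversely, let `A` be an atom and `R = μ Aᶜ`. Every `μ (B ∩ A)` is `0` or `1 - R`, so a spectral
projection `Q` of `R` for `(-∞, c]` commutes with it and the atom splits along `Q`. Removing the
part under `1 - Q` leaves total mass `R (1 - Q) + Q`, which is bounded below by `c`. Extremality,
read off at `Aᶜ`, makes `R` unitarily equivalent to `1 - Q + R Q`, whose spectrum misses `(c, 1)`.
As `c ∈ (0, 1)` is arbitrary, `R` is a projection, and so is `μ A`.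

By separability a maximal disjoint family of atoms inside `B` is countable, and atomicity makes it
exhaust `B` up to a null set. Each of its values kills `μ Bᶜ`, so `μ B * μ Bᶜ = 0`. -/

open MeasureTheory
open scoped InnerProductSpace

/-! ### Square roots, polar decomposition and spectral projections. -/

section HilbertOperators

variable {H : Type*} [NormedAddCommGroup H] [InnerProductSpace ℂ H] [CompleteSpace H]

/-- An invertible positive operator has an invertible positive square root that commutes with
everything the operator commutes with. -/
theorem exists_units_sqrt {E : H →L[ℂ] H} (hE : 0 ≤ E) (hu : IsUnit E) :
    ∃ G : (H →L[ℂ] H)ˣ, star (G : H →L[ℂ] H) = G ∧ (G : H →L[ℂ] H) * G = E ∧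
      ∀ C : H →L[ℂ] H, Commute E C → Commute (G : H →L[ℂ] H) C := by
  refine ⟨((CFC.isUnit_sqrt_iff E hE).2 hu).unit, ?_, ?_, ?_⟩
  · exact (IsSelfAdjoint.of_nonneg (CFC.sqrt_nonneg E)).star_eq
  · exact CFC.sqrt_mul_sqrt_self E hE
  · intro C hC
    exact hC.cfcₙ_nnreal _

/-- Polar decomposition of a unit in a star monoid, given the square root of `star T * T`. -/
theorem units_polar {R : Type*} [Monoid R] [StarMul R] {T G : Rˣ} (hG : star G = G)
    (h : G * G = star T * T) :
    (T * G⁻¹) * star (T * G⁻¹) = 1 ∧ star (T * G⁻¹) * (T * G⁻¹) = 1 ∧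
      (T * G⁻¹)⁻¹ * T = G := by
  have hs : star (T * G⁻¹) = G⁻¹ * star T := by rw [star_mul, star_inv, hG]
  have h1 : star (T * G⁻¹) * (T * G⁻¹) = 1 := by
    rw [hs, mul_assoc, ← mul_assoc (star T), ← h]; group
  refine ⟨mul_eq_one_comm.1 h1, h1, by group⟩

/-- Polar decomposition of an invertible operator. -/
theorem exists_unitary_polar {T : H →L[ℂ] H} (hT : IsUnit T) :
    ∃ U ∈ unitary (H →L[ℂ] H), ∀ P : H →L[ℂ] H, Commute (star T * T) P →
      U * P * star U * T = T * P := by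
  obtain ⟨G, hGs, hGG, hGc⟩ := exists_units_sqrt (star_mul_self_nonneg T) (hT.star.mul hT)
  obtain ⟨T, rfl⟩ := hT
  obtain ⟨h1, h2, h3⟩ := units_polar (T := T) (G := G) (Units.ext hGs) (Units.ext hGG)
  have h4 : (T * G⁻¹)⁻¹ = star (T * G⁻¹) := inv_eq_of_mul_eq_one_right h1
  rw [h4] at h3
  have h5 : star ((T * G⁻¹ : (H →L[ℂ] H)ˣ) : H →L[ℂ] H) * T = G := congrArg Units.val h3
  refine ⟨(T * G⁻¹ : (H →L[ℂ] H)ˣ),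
    Unitary.mem_iff.2 ⟨congrArg Units.val h2, congrArg Units.val h1⟩, fun P hP => ?_⟩
  rw [mul_assoc, h5, mul_assoc, ← (hGc P hP).eq, ← mul_assoc, ← Units.val_mul,
    inv_mul_cancel_right]

/-- The projection onto the kernel of an operator. -/
theorem exists_isStarProjection_ker (X : H →L[ℂ] H) :
    ∃ Q : H →L[ℂ] H, IsStarProjection Q ∧ X * Q = 0 ∧
      ∀ Z : H →L[ℂ] H, X * Z = 0 → Q * Z = Z := by
  have : CompleteSpace (LinearMap.ker (X : H →ₗ[ℂ] H)) :=
    (ContinuousLinearMap.isClosed_ker X).completeSpace_coe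
  refine ⟨(LinearMap.ker (X : H →ₗ[ℂ] H)).starProjection, isStarProjection_starProjection, ?_, ?_⟩
  · ext v
    exact LinearMap.mem_ker.1
      (Submodule.starProjection_apply_mem (LinearMap.ker (X : H →ₗ[ℂ] H)) v)
  · intro Z hZ
    ext v
    exact Submodule.starProjection_eq_self_iff.2 (LinearMap.mem_ker.2 (DFunLike.congr_fun hZ v))

/-- The spectral projection of a self-adjoint operator `R` for the half-line `(-∞, c]`. -/
theorem exists_spectral_projection {R : H →L[ℂ] H} (hR : IsSelfAdjoint R) (c : ℝ) :
    ∃ Q : H →L[ℂ] H, IsStarProjection Q ∧ Commute R Q ∧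
      0 ≤ (c • 1 - R) * Q ∧ 0 ≤ (R - c • 1) * (1 - Q) := by
  have ha : IsSelfAdjoint (R - c • 1) :=
    hR.sub (IsSelfAdjoint.smul (IsSelfAdjoint.all c) (IsSelfAdjoint.one _))
  -- The kernel of the positive part of `R - c` is the spectral subspace for `(-∞, c]`; it contains
  -- the range of the negative part.
  obtain ⟨Q, hQ, hXQ, hQZ⟩ := exists_isStarProjection_ker (R - c • 1)⁺
  have hXY := CFC.posPart_sub_negPart (R - c • 1) ha
  have hX : (0 : H →L[ℂ] H) ≤ (R - c • 1)⁺ := CFC.posPart_nonneg _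
  have hY : (0 : H →L[ℂ] H) ≤ (R - c • 1)⁻ := CFC.negPart_nonneg _
  have hQY := hQZ _ (CFC.posPart_mul_negPart (R - c • 1))
  have hYQ : (R - c • 1)⁻ * Q = (R - c • 1)⁻ := by
    have := congrArg star hQY
    rwa [star_mul, hQ.isSelfAdjoint.star_eq, (IsSelfAdjoint.of_nonneg hY).star_eq] at this
  have h1 : (R - c • 1) * Q = -(R - c • 1)⁻ := by
    conv_lhs => rw [← hXY, sub_mul, hXQ, hYQ, zero_sub]
  have hQX : Q * (R - c • 1)⁺ = 0 := by
    have := congrArg star hXQ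
    rwa [star_mul, hQ.isSelfAdjoint.star_eq, (IsSelfAdjoint.of_nonneg hX).star_eq,
      star_zero] at this
  have h2 : Q * (R - c • 1) = -(R - c • 1)⁻ := by
    conv_lhs => rw [← hXY, mul_sub, hQX, hQY, zero_sub]
  refine ⟨Q, hQ, ?_, ?_, ?_⟩
  · have h := h1.trans h2.symm
    rw [sub_mul, mul_sub, smul_mul_assoc, mul_smul_comm, one_mul, mul_one] at h
    exact sub_left_injective h
  · rw [← neg_sub R, neg_mul, h1, neg_neg]
    exact hY
  · rw [mul_sub, mul_one, h1, sub_neg_eq_add]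
    nth_rw 1 [← hXY]
    rw [sub_add_cancel]
    exact hX

theorem isUnit_of_smul_one_le {E : H →L[ℂ] H} {c : ℝ} (hc : 0 < c) (h : c • 1 ≤ E) :
    0 ≤ E ∧ IsUnit E := by
  have h0 : (0 : H →L[ℂ] H) ≤ c • 1 := smul_nonneg hc.le zero_le_one
  refine ⟨h0.trans h, CStarAlgebra.isUnit_of_le (c • 1) h ⟨h0, ?_⟩⟩
  have : IsUnit (algebraMap ℝ (H →L[ℂ] H) c) := (IsUnit.mk0 c hc.ne').map _
  rwa [Algebra.algebraMap_eq_smul_one] at this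

/-- A positive contraction whose spectrum avoids `(c, 1)` for all `c ∈ (0, 1)` is a projection. -/
theorem mul_self_eq_of_forall_nonneg {R : H →L[ℂ] H} (h0 : 0 ≤ R) (h1 : R ≤ 1)
    (h : ∀ c : ℝ, 0 < c → c < 1 → 0 ≤ (c • 1 - R) * (1 - R)) : R * R = R := by
  have hp : 0 ≤ R * (1 - R) :=
    Commute.mul_nonneg h0 (sub_nonneg.2 h1) ((Commute.one_right R).sub_right (Commute.refl R))
  have hn : ‖R * (1 - R)‖ ≤ 0 := by
    refine le_of_forall_gt_imp_ge_of_dense fun c hc => ?_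
    -- The hypothesis gives `R (1 - R) ≤ c (1 - R) ≤ c`; the minimum keeps the constant below `1`.
    have hc' : 0 < min c (1 / 2) := by positivity
    have h2 : R * (1 - R) ≤ min c (1 / 2) • 1 := by
      have := h (min c (1 / 2)) hc' ((min_le_right _ _).trans_lt (by norm_num))
      rw [sub_mul, sub_nonneg, smul_mul_assoc, one_mul] at this
      refine this.trans (smul_le_smul_of_nonneg_left (sub_le_self _ h0) hc'.le)
    have h3 := CStarAlgebra.norm_le_norm_of_nonneg_of_le hp h2
    refine h3.trans ?_
    rw [norm_smul, Real.norm_of_nonneg hc'.le]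
    calc _ ≤ min c (1 / 2) * 1 :=
          mul_le_mul_of_nonneg_left ContinuousLinearMap.norm_id_le hc'.le
      _ ≤ c := by rw [mul_one]; exact min_le_left _ _
  have h3 := norm_le_zero_iff.1 hn
  rw [mul_sub, mul_one, sub_eq_zero] at h3
  exact h3.symm

/-- With `V = √S T`, the hypothesis says `V^* V = 0`, so `V = 0`. -/
theorem mul_eq_zero_of_star_mul_mul_eq_zero {S T : H →L[ℂ] H} (hS : 0 ≤ S)
    (h : star T * S * T = 0) : S * T = 0 := by
  have h1 : star (CFC.sqrt S * T) * (CFC.sqrt S * T) = 0 := by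
    rw [star_mul, (IsSelfAdjoint.of_nonneg (CFC.sqrt_nonneg S)).star_eq, ← h]
    conv_rhs => rw [← CFC.sqrt_mul_sqrt_self S hS]
    simp only [mul_assoc]
  have h2 := CStarRing.star_mul_self_eq_zero_iff _ |>.1 h1
  rw [← CFC.sqrt_mul_sqrt_self S hS, mul_assoc, h2, mul_zero]

end HilbertOperators

/-! ### Additivity, restriction and sums of POVMs. -/

namespace POVM

variable {X : Type*} [MeasurableSpace X] {H : Type*} [NormedAddCommGroup H]
  [InnerProductSpace ℂ H] [CompleteSpace H]

theorem nonneg (μ : POVM X H) {A : Set X} (hA : MeasurableSet A) : 0 ≤ μ A :=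
  ContinuousLinearMap.nonneg_iff_isPositive _ |>.2 (μ.isPositive' A hA)

theorem star_apply (μ : POVM X H) {A : Set X} (hA : MeasurableSet A) : star (μ A) = μ A :=
  (IsSelfAdjoint.of_nonneg (μ.nonneg hA)).star_eq

theorem apply_union (μ : POVM X H) {A B : Set X} (h : Disjoint A B) (hA : MeasurableSet A)
    (hB : MeasurableSet B) : μ (A ∪ B) = μ A + μ B := by
  refine ContinuousLinearMap.ext fun k => ext_inner_left ℂ fun h' => ?_
  obtain ⟨ν, hν⟩ := μ.isComplexMeasure' h' k
  rw [_root_.add_apply, inner_add_right, ← hν _ hA, ← hν _ hB, ← hν _ (hA.union hB),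
    VectorMeasure.of_union h hA hB]

theorem apply_empty (μ : POVM X H) : μ ∅ = 0 := by
  have := μ.apply_union (disjoint_bot_left (a := (∅ : Set X))) .empty .empty
  rwa [Set.union_empty, left_eq_add] at this

theorem apply_inter_add_inter_compl (μ : POVM X H) {A B : Set X} (hA : MeasurableSet A)
    (hB : MeasurableSet B) : μ (B ∩ A) + μ (B ∩ Aᶜ) = μ B := by
  rw [← μ.apply_union _ (hB.inter hA) (hB.inter hA.compl), Set.inter_union_compl]
  exact Set.disjoint_left.2 fun x hx hx' => hx'.2 hx.2

theorem apply_add_compl (μ : POVM X H) {A : Set X} (hA : MeasurableSet A) :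
    μ A + μ Aᶜ = μ Set.univ := by
  simpa using μ.apply_inter_add_inter_compl hA .univ

theorem mono (μ : POVM X H) {A B : Set X} (hA : MeasurableSet A) (hB : MeasurableSet B)
    (h : A ⊆ B) : μ A ≤ μ B := by
  have := μ.apply_inter_add_inter_compl hA hB
  rw [Set.inter_eq_right.2 h] at this
  rw [← this]
  exact le_add_of_nonneg_right (μ.nonneg (hB.inter hA.compl))

theorem hasSum_inner (μ : POVM X H) {ι : Type*} [Countable ι] {f : ι → Set X}
    (hf : ∀ i, MeasurableSet (f i)) (hd : Pairwise (Function.onFun Disjoint f)) (h k : H) :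
    HasSum (fun i => ⟪h, μ (f i) k⟫_ℂ) ⟪h, μ (⋃ i, f i) k⟫_ℂ := by
  obtain ⟨ν, hν⟩ := μ.isComplexMeasure' h k
  have := ν.hasSum_of_disjoint_iUnion hf hd
  rw [hν _ (.iUnion hf)] at this
  simpa only [hν _ (hf _)] using this

/-- If every piece of a countable partition annihilates the range of `Z`, so does the whole. -/
theorem apply_iUnion_mul_eq_zero (μ : POVM X H) {ι : Type*} [Countable ι] {f : ι → Set X}
    (hf : ∀ i, MeasurableSet (f i)) (hd : Pairwise (Function.onFun Disjoint f))
    {Z : H →L[ℂ] H} (h : ∀ i, μ (f i) * Z = 0) : μ (⋃ i, f i) * Z = 0 := by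
  refine ContinuousLinearMap.ext fun k => ext_inner_left ℂ fun h' => ?_
  refine (μ.hasSum_inner hf hd h' (Z k)).unique ?_
  have h0 : ∀ i, μ (f i) (Z k) = 0 := fun i => DFunLike.congr_fun (h i) k
  simp only [h0, _root_.zero_apply, inner_zero_right]
  exact hasSum_zero

open Classical in
/-- The POVM `B ↦ S^* μ(B ∩ A) S`. -/
noncomputable def conjRestrict (μ : POVM X H) {A : Set X} (hA : MeasurableSet A)
    (S : H →L[ℂ] H) : POVM X H where
  toFun B := if MeasurableSet B then star S * μ (B ∩ A) * S else 0
  not_measurable' B hB := if_neg hB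
  isPositive' B hB := by
    rw [if_pos hB]
    exact (ContinuousLinearMap.nonneg_iff_isPositive _).1
      (star_left_conjugate_nonneg (μ.nonneg (hB.inter hA)) S)
  isComplexMeasure' h k := by
    obtain ⟨ν, hν⟩ := μ.isComplexMeasure' (S h) (S k)
    refine ⟨ν.restrict A, fun B hB => ?_⟩
    rw [if_pos hB, VectorMeasure.restrict_apply _ hA hB, hν _ (hB.inter hA)]
    exact (ContinuousLinearMap.adjoint_inner_right S _ _).symm

theorem conjRestrict_apply (μ : POVM X H) {A B : Set X} (hA : MeasurableSet A)
    (S : H →L[ℂ] H) (hB : MeasurableSet B) :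
    μ.conjRestrict hA S B = star S * μ (B ∩ A) * S := if_pos hB

/-- The sum of two POVMs. -/
protected def add (μ ν : POVM X H) : POVM X H where
  toFun B := μ B + ν B
  not_measurable' B hB := by rw [μ.not_measurable' B hB, ν.not_measurable' B hB, add_zero]
  isPositive' B hB := (μ.isPositive' B hB).add (ν.isPositive' B hB)
  isComplexMeasure' h k := by
    obtain ⟨m, hm⟩ := μ.isComplexMeasure' h k
    obtain ⟨n, hn⟩ := ν.isComplexMeasure' h k
    refine ⟨m + n, fun B hB => ?_⟩
    rw [_root_.add_apply, hm B hB, hn B hB, _root_.add_apply, inner_add_right]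

theorem toFun_add (μ ν : POVM X H) (B : Set X) : μ.add ν B = μ B + ν B := rfl

/-! ### C*-extremality: use of the definition, and the spectral case. -/

/-- Summands of a C*-extreme POVM with invertible total mass are conjugate to it. -/
theorem IsCStarExtreme.exists_conj_of_add {μ ν₁ ν₂ : POVM X H} (hμ : μ.IsCStarExtreme)
    (h : ∀ B, MeasurableSet B → μ B = ν₁ B + ν₂ B) (h₁ : IsUnit (ν₁ Set.univ))
    (h₂ : IsUnit (ν₂ Set.univ)) :
    ∃ U ∈ unitary (H →L[ℂ] H), ∃ G : (H →L[ℂ] H)ˣ, (G : H →L[ℂ] H) * G = ν₁ Set.univ ∧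
      (∀ C, Commute (ν₁ Set.univ) C → Commute (G : H →L[ℂ] H) C) ∧
      ∀ B, MeasurableSet B → ν₁ B = G * (star U * μ B * U) * G := by
  have key : ∀ (ν : POVM X H) (G : (H →L[ℂ] H)ˣ), star (G : H →L[ℂ] H) = G →
      ∀ B, MeasurableSet B →
      star (G : H →L[ℂ] H) * ν.conjRestrict .univ ↑G⁻¹ B * G = ν B := by
    intro ν G hG B hB
    have hGi : star (↑G⁻¹ : H →L[ℂ] H) = ↑G⁻¹ := by
      have h : star G = G := Units.ext hG
      rw [← Units.coe_star, star_inv, h]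
    rw [conjRestrict_apply _ _ _ hB, hG, hGi, Set.inter_univ]
    simp [mul_assoc]
  have norm : ∀ (ν : POVM X H) (G : (H →L[ℂ] H)ˣ), star (G : H →L[ℂ] H) = G →
      (G : H →L[ℂ] H) * G = ν Set.univ → (ν.conjRestrict .univ ↑G⁻¹).IsNormalized := by
    intro ν G hG hGG
    have h3 := key ν G hG _ .univ
    rw [← hGG, hG] at h3
    have h4 := G.isUnit.mul_right_cancel h3
    exact G.isUnit.mul_left_cancel (h4.trans (mul_one _).symm)
  obtain ⟨G₁, s₁, g₁, c₁⟩ := exists_units_sqrt (ν₁.nonneg .univ) h₁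
  obtain ⟨G₂, s₂, g₂, -⟩ := exists_units_sqrt (ν₂.nonneg .univ) h₂
  -- The coefficients are the square roots of the total masses, and their inverses normalize the
  -- summands.
  have hc : μ.IsProperCStarCombination
      ![ν₁.conjRestrict .univ ↑G₁⁻¹, ν₂.conjRestrict .univ ↑G₂⁻¹]
      ![(G₁ : H →L[ℂ] H), (G₂ : H →L[ℂ] H)] := by
    refine ⟨?_, ?_, ?_, ?_⟩
    · exact Fin.forall_fin_two.2 ⟨norm _ _ s₁ g₁, norm _ _ s₂ g₂⟩
    · exact Fin.forall_fin_two.2 ⟨G₁.isUnit, G₂.isUnit⟩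
    · rw [Fin.sum_univ_two]
      change star (G₁ : H →L[ℂ] H) * G₁ + star (G₂ : H →L[ℂ] H) * G₂ = 1
      rw [s₁, s₂, g₁, g₂, ← h _ .univ, hμ.1]
    · intro B hB
      rw [Fin.sum_univ_two, h B hB, ← key ν₁ G₁ s₁ B hB, ← key ν₂ G₂ s₂ B hB]
      rfl
  obtain ⟨U, hU, hUB⟩ := hμ.2 2 _ _ hc 0
  refine ⟨U, hU, G₁, g₁, c₁, fun B hB => ?_⟩
  rw [← hUB B hB, ← key ν₁ G₁ s₁ B hB, s₁]
  rfl

/-- Spectral POVMs are C*-extreme. -/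
theorem IsSpectral.isCStarExtreme {μ : POVM X H} (hμ : μ.IsSpectral) : μ.IsCStarExtreme := by
  refine ⟨hμ.2, ?_⟩
  rintro n ν T ⟨hν, hT, -, hsum⟩ i
  have hle : ∀ A, MeasurableSet A → star (T i) * ν i A * T i ≤ μ A := fun A hA => by
    rw [hsum A hA]
    exact Finset.single_le_sum (f := fun j => star (T j) * ν j A * T j)
      (fun j _ => star_left_conjugate_nonneg ((ν j).nonneg hA) _) (Finset.mem_univ i)
  -- Compressing `T^* ν(A) T ≤ μ(A)` by `Z` squeezes the left side to zero.
  have hzero : ∀ A, MeasurableSet A → ∀ Z, star Z = Z → μ A * Z = 0 → ν i A * (T i * Z) = 0 := by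
    intro A hA Z hZs hZ
    refine mul_eq_zero_of_star_mul_mul_eq_zero ((ν i).nonneg hA) (le_antisymm ?_ ?_)
    · have := star_left_conjugate_le_conjugate (hle A hA) Z
      rw [mul_assoc _ (μ A), hZ, mul_zero] at this
      rw [star_mul]
      simpa only [mul_assoc] using this
    · exact star_left_conjugate_nonneg ((ν i).nonneg hA) _
  have hmul : ∀ A, MeasurableSet A → ν i A * T i = T i * μ A := by
    intro A hA
    have hc : μ Aᶜ = 1 - μ A := by rw [← hμ.2, ← μ.apply_add_compl hA, add_sub_cancel_left]
    have hc' : ν i Aᶜ = 1 - ν i A := by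
      rw [← hν i, ← (ν i).apply_add_compl hA, add_sub_cancel_left]
    have hid := (hμ.1 A hA).isIdempotentElem.eq
    have e1 := hzero A hA (μ Aᶜ) (μ.star_apply hA.compl) (by rw [hc, mul_sub, hid, mul_one, sub_self])
    have e2 := hzero Aᶜ hA.compl (μ A) (μ.star_apply hA) (by rw [hc, sub_mul, hid, one_mul, sub_self])
    rw [hc, mul_sub, mul_one, mul_sub, sub_eq_zero] at e1
    rw [hc', sub_mul, one_mul, sub_eq_zero] at e2
    rw [e1, ← e2]
  obtain ⟨U, hU, hUP⟩ := exists_unitary_polar (hT i)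
  refine ⟨star U, Unitary.star_mem hU, fun A hA => ?_⟩
  refine (hT i).mul_right_cancel ?_
  rw [star_star, hUP, hmul A hA]
  have h1 := hmul A hA
  -- Together with its adjoint, the intertwining relation shows that `T^* T` commutes with `μ A`.
  have h2 := congrArg star h1
  rw [star_mul, star_mul, μ.star_apply hA, (ν i).star_apply hA] at h2
  change _ * _ = _ * _
  rw [mul_assoc, ← h1, ← mul_assoc, h2, mul_assoc]

end POVM

/-! ### Values on atoms. -/

namespace POVM

variable {X : Type*} [MeasurableSpace X] {H : Type*} [NormedAddCommGroup H]
  [InnerProductSpace ℂ H] [CompleteSpace H]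

theorem conjRestrict_smul_apply (μ : POVM X H) {A B : Set X} (hA : MeasurableSet A) (a : ℝ)
    {S : H →L[ℂ] H} (hS : star S = S) (hB : MeasurableSet B) :
    μ.conjRestrict hA (a • S) B = (a * a) • (S * μ (B ∩ A) * S) := by
  rw [conjRestrict_apply _ _ _ hB, star_smul, hS, star_trivial, smul_mul_assoc, smul_mul_assoc,
    mul_smul_comm, smul_smul]

/-- Cutting an atom of a C*-extreme POVM along a commuting projection `Q`, such that the remaining
total mass is invertible, does not change the unitary equivalence class of the complement. -/
theorem IsCStarExtreme.exists_unitary_of_isAtomFor {μ : POVM X H} (hμ : μ.IsCStarExtreme)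
    {A : Set X} (hA : μ.IsAtomFor A) {Q : H →L[ℂ] H} (hQ : IsStarProjection Q)
    (hc : Commute (μ Aᶜ) Q) {c : ℝ} (h0 : 0 < c) (h : c • 1 ≤ μ Aᶜ * (1 - Q) + Q) :
    ∃ U ∈ unitary (H →L[ℂ] H), star U * μ Aᶜ * U = 1 - Q + μ Aᶜ * Q := by
  have hAm := hA.1
  have hid : Q * Q = Q := hQ.isIdempotentElem.eq
  have hs : star Q = Q := hQ.isSelfAdjoint.star_eq
  have hsP : star (1 - Q) = 1 - Q := by rw [star_sub, star_one, hs]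
  have hidP : (1 - Q) * (1 - Q) = 1 - Q := hQ.isIdempotentElem.one_sub.eq
  have hPQ : (1 - Q) * Q = 0 := by rw [sub_mul, one_mul, hid, sub_self]
  have hQP : Q * (1 - Q) = 0 := by rw [mul_sub, mul_one, hid, sub_self]
  have hT : μ A = 1 - μ Aᶜ := by rw [← hμ.1, ← μ.apply_add_compl hAm, add_sub_cancel_right]
  have hTQ : Commute (μ A) Q := by rw [hT]; exact (Commute.one_left Q).sub_left hc
  have hsplit : ∀ B, MeasurableSet B →
      μ (B ∩ A) = Q * μ (B ∩ A) * Q + (1 - Q) * μ (B ∩ A) * (1 - Q) := by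
    intro B hB
    rcases hA.2.2 (B ∩ A) (hB.inter hAm) Set.inter_subset_right with h | h
    · simp [h]
    · have hTP : Commute (μ A) (1 - Q) := (Commute.one_right _).sub_right hTQ
      rw [h, ← hTQ.eq, ← hTP.eq, mul_assoc, mul_assoc, hid, hidP, ← mul_add, add_sub_cancel,
        mul_one]
  have h1s : star (1 : H →L[ℂ] H) = 1 := star_one _
  -- Since `(3/5)² + (4/5)² = 1`, the part kept is shared between both summands, making both total
  -- masses invertible; the part under `1 - Q` goes wholly to `ν₂`.
  let ν₁ := (μ.conjRestrict hAm.compl ((3 / 5 : ℝ) • 1)).add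
    (μ.conjRestrict hAm ((3 / 5 : ℝ) • Q))
  let ν₂ := ((μ.conjRestrict hAm.compl ((4 / 5 : ℝ) • 1)).add
    (μ.conjRestrict hAm ((4 / 5 : ℝ) • Q))).add (μ.conjRestrict hAm (1 - Q))
  have e₁ : ∀ B, MeasurableSet B →
      ν₁ B = (3 / 5 * (3 / 5) : ℝ) • (μ (B ∩ Aᶜ) + Q * μ (B ∩ A) * Q) := by
    intro B hB
    rw [toFun_add, conjRestrict_smul_apply _ _ _ h1s hB, conjRestrict_smul_apply _ _ _ hs hB,
      one_mul, mul_one, smul_add]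
  have e₂ : ∀ B, MeasurableSet B →
      ν₂ B = (4 / 5 * (4 / 5) : ℝ) • (μ (B ∩ Aᶜ) + Q * μ (B ∩ A) * Q)
        + (1 - Q) * μ (B ∩ A) * (1 - Q) := by
    intro B hB
    rw [toFun_add, toFun_add, conjRestrict_smul_apply _ _ _ h1s hB,
      conjRestrict_smul_apply _ _ _ hs hB, conjRestrict_apply _ _ _ hB, hsP, one_mul, mul_one,
      smul_add]
  have htot : μ (Set.univ ∩ Aᶜ) + Q * μ (Set.univ ∩ A) * Q = μ Aᶜ * (1 - Q) + Q := by
    rw [Set.univ_inter, Set.univ_inter, ← hTQ.eq, mul_assoc, hid, hT, mul_sub, sub_mul, mul_one,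
      one_mul]
    abel
  have t₁ : ν₁ Set.univ = (3 / 5 * (3 / 5) : ℝ) • (μ Aᶜ * (1 - Q) + Q) := by
    rw [e₁ _ .univ, htot]
  have scale : ∀ r : ℝ, 0 ≤ r → (r * c) • (1 : H →L[ℂ] H) ≤ r • (μ Aᶜ * (1 - Q) + Q) := by
    intro r hr
    rw [mul_smul]
    exact smul_le_smul_of_nonneg_left h hr
  obtain ⟨U, hU, G, hG, hGc, hUB⟩ := hμ.exists_conj_of_add (ν₁ := ν₁) (ν₂ := ν₂) (by
    intro B hB
    rw [e₁ B hB, e₂ B hB, ← add_assoc, ← add_smul, ← μ.apply_inter_add_inter_compl hAm hB]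
    nth_rw 1 [hsplit B hB]
    norm_num
    abel) (by
    rw [t₁]
    exact (isUnit_of_smul_one_le (by positivity) (scale _ (by norm_num))).2) (by
    rw [e₂ _ .univ, htot]
    refine (isUnit_of_smul_one_le (c := 4 / 5 * (4 / 5) * c) (by positivity)
      ((scale _ (by norm_num)).trans (le_add_of_nonneg_right ?_))).2
    have := star_left_conjugate_nonneg (μ.nonneg (MeasurableSet.univ.inter hAm)) (1 - Q)
    rwa [hsP] at this)
  refine ⟨U, hU, ?_⟩
  have hcP : Commute (μ Aᶜ) (1 - Q) := (Commute.one_right _).sub_right hc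
  have hQP' : Commute Q (1 - Q) := (Commute.one_right _).sub_right (Commute.refl _)
  have hcomm : Commute (G : H →L[ℂ] H) (1 - Q + μ Aᶜ * Q) := by
    refine hGc _ ?_
    rw [t₁]
    refine Commute.smul_left ?_ _
    refine Commute.add_left (Commute.mul_left ?_ ?_) ?_
    · exact hcP.add_right ((Commute.refl _).mul_right hc)
    · exact (Commute.refl _).add_right (hcP.symm.mul_right hQP'.symm)
    · exact hQP'.add_right (hc.symm.mul_right (Commute.refl _))
  have e3 : ν₁ Aᶜ = (3 / 5 * (3 / 5) : ℝ) • μ Aᶜ := by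
    rw [e₁ _ hAm.compl, Set.inter_self, Set.compl_inter_self, apply_empty, mul_zero, zero_mul,
      add_zero]
  -- `R` factors as the unscaled total mass of `ν₁` times the operator sought; this identifies the
  -- latter after cancelling `G` on both sides.
  have e4 : (μ Aᶜ * (1 - Q) + Q) * (1 - Q + μ Aᶜ * Q) = μ Aᶜ := by
    have a1 : μ Aᶜ * (1 - Q) * (1 - Q) = μ Aᶜ * (1 - Q) := by rw [mul_assoc, hidP]
    have a2 : μ Aᶜ * (1 - Q) * (μ Aᶜ * Q) = 0 := by
      rw [hc.eq, mul_assoc, ← mul_assoc (1 - Q), hPQ, zero_mul, mul_zero]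
    have a3 : Q * (μ Aᶜ * Q) = μ Aᶜ * Q := by rw [hc.eq, ← mul_assoc, hid]
    rw [add_mul, mul_add, mul_add, a1, a2, a3, hQP, add_zero, zero_add, ← mul_add, sub_add_cancel,
      mul_one]
  have e5 : G * (1 - Q + μ Aᶜ * Q) * G = ν₁ Aᶜ := by
    rw [mul_assoc, ← hcomm.eq, ← mul_assoc, hG, t₁, smul_mul_assoc, e4, e3]
  exact G.isUnit.mul_left_cancel (G.isUnit.mul_right_cancel ((hUB _ hAm.compl).symm.trans e5.symm))

/-- The value of a C*-extreme POVM on an atom is a projection. -/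
theorem IsCStarExtreme.isStarProjection_of_isAtomFor {μ : POVM X H} (hμ : μ.IsCStarExtreme)
    {A : Set X} (hA : μ.IsAtomFor A) : IsStarProjection (μ A) := by
  have hT : μ A = 1 - μ Aᶜ := by rw [← hμ.1, ← μ.apply_add_compl hA.1, add_sub_cancel_right]
  have hR0 := μ.nonneg hA.1.compl
  have hR1 : μ Aᶜ ≤ 1 := by rw [← hμ.1]; exact μ.mono hA.1.compl .univ (Set.subset_univ _)
  have hRs := IsSelfAdjoint.of_nonneg hR0
  suffices h : μ Aᶜ * μ Aᶜ = μ Aᶜ by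
    rw [hT]
    exact (IsStarProjection.mk h hRs).one_sub
  refine mul_self_eq_of_forall_nonneg hR0 hR1 fun c hc0 hc1 => ?_
  obtain ⟨Q, hQ, hRQ, hlow, hup⟩ := exists_spectral_projection hRs c
  have hid : Q * Q = Q := hQ.isIdempotentElem.eq
  have hle : c • 1 ≤ μ Aᶜ * (1 - Q) + Q := by
    have hQ0 : 0 ≤ (1 - c) • Q := smul_nonneg (by linarith) hQ.nonneg
    have := add_nonneg hup hQ0
    rw [← sub_nonneg]
    convert this using 1
    rw [sub_mul, smul_mul_assoc, one_mul, sub_smul, one_smul, smul_sub]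
    abel
  obtain ⟨U, hU, hUR⟩ := hμ.exists_unitary_of_isAtomFor hA hQ hRQ hc0 hle
  obtain ⟨hU1, hU2⟩ := Unitary.mem_iff.1 hU
  -- With `R' = 1 - Q + R Q`, the product `(c - R') (1 - R')` equals `(c - R) Q (1 - R)`, because
  -- `R'` is the identity on the range of `1 - Q`.
  have hpos : 0 ≤ (c • 1 - (1 - Q + μ Aᶜ * Q)) * (1 - (1 - Q + μ Aᶜ * Q)) := by
    have hcomm : Commute ((c • 1 - μ Aᶜ) * Q) (1 - μ Aᶜ) := by
      have hr : ∀ Z, Commute (μ Aᶜ) Z → Commute (1 - μ Aᶜ) Z :=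
        fun Z hZ => (Commute.one_left Z).sub_left hZ
      refine Commute.symm (hr _ ?_)
      exact (((Commute.one_right _).smul_right c).sub_right (Commute.refl _)).mul_right hRQ
    have h1 := hcomm.mul_nonneg hlow (sub_nonneg.2 hR1)
    convert h1 using 1
    have hQR : Q * μ Aᶜ = μ Aᶜ * Q := hRQ.eq.symm
    have a3 : Q * (μ Aᶜ * Q) = μ Aᶜ * Q := by rw [← mul_assoc, hQR, mul_assoc, hid]
    simp only [sub_mul, mul_sub, add_mul, mul_add, smul_mul_assoc, mul_one, one_mul, mul_assoc,
      hid, a3, hQR]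
    abel
  have h2 := star_left_conjugate_nonneg hpos (star U)
  rw [← hUR, star_star] at h2
  have h3 : ∀ a : ℝ, U * (a • 1 - star U * μ Aᶜ * U) * star U = a • 1 - μ Aᶜ := by
    intro a
    rw [mul_sub, sub_mul, mul_smul_comm, smul_mul_assoc, mul_one, hU2]
    congr 1
    calc _ = (U * star U) * μ Aᶜ * (U * star U) := by simp only [mul_assoc]
      _ = μ Aᶜ := by rw [hU2, one_mul, mul_one]
  have h4 := h3 1
  rw [one_smul] at h4
  rw [← h3 c, ← h4]
  convert h2 using 1
  calc _ = U * (c • 1 - star U * μ Aᶜ * U) * (star U * U) * (1 - star U * μ Aᶜ * U) * star U := by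
        simp only [mul_assoc]
    _ = _ := by rw [hU1, mul_one]; simp only [mul_assoc]

/-! ### From atoms to all measurable sets. -/

/-- Disjoint sets on which a normalized POVM takes projections as values have orthogonal values. -/
theorem IsNormalized.mul_eq_zero_of_disjoint {μ : POVM X H} (hμ : μ.IsNormalized) {A B : Set X}
    (hA : MeasurableSet A) (hB : MeasurableSet B) (hd : Disjoint A B)
    (hp : IsStarProjection (μ A)) : μ B * μ A = 0 := by
  refine mul_eq_zero_of_star_mul_mul_eq_zero (μ.nonneg hB)
    (le_antisymm ?_ (star_left_conjugate_nonneg (μ.nonneg hB) _))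
  have h1 : μ A + μ B ≤ 1 := by
    rw [← μ.apply_union hd hA hB, ← hμ]
    exact μ.mono (hA.union hB) .univ (Set.subset_univ _)
  have h2 := star_left_conjugate_le_conjugate h1 (μ A)
  have hid := hp.isIdempotentElem.eq
  rw [μ.star_apply hA, mul_one, hid, mul_add, add_mul, hid, hid] at h2
  rw [μ.star_apply hA]
  exact le_of_add_le_add_left (h2.trans (add_zero _).ge)

/-- Families of disjoint sets whose values are nonzero projections are countable in a separable space. -/
theorem IsNormalized.countable_of_pairwiseDisjoint [TopologicalSpace.SeparableSpace H]
    {μ : POVM X H} (hμ : μ.IsNormalized) {S : Set (Set X)} (hd : S.PairwiseDisjoint id)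
    (hm : ∀ A ∈ S, MeasurableSet A) (hne : ∀ A ∈ S, μ A ≠ 0)
    (hp : ∀ A ∈ S, IsStarProjection (μ A)) : S.Countable := by
  -- Each projection gets the open set of vectors closer to its range than to its kernel;
  -- orthogonality makes these sets disjoint.
  refine Set.PairwiseDisjoint.countable_of_isOpen (s := fun A => {v : H | ‖v - μ A v‖ < ‖μ A v‖})
    ?_ ?_ ?_
  · intro A hA B hB hAB
    refine Set.disjoint_left.2 fun v (hv : ‖v - μ A v‖ < ‖μ A v‖) (hv' : ‖v - μ B v‖ < ‖μ B v‖) => ?_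
    have key : ∀ C ∈ S, ∀ D ∈ S, Disjoint C D → ‖μ D v‖ ≤ ‖v - μ C v‖ := by
      intro C hC D hD h
      have h0 : μ D (μ C v) = 0 :=
        DFunLike.congr_fun (hμ.mul_eq_zero_of_disjoint (hm C hC) (hm D hD) h (hp C hC)) v
      have h1 : ‖μ D (v - μ C v)‖ ≤ 1 * ‖v - μ C v‖ :=
        ContinuousLinearMap.le_of_opNorm_le _ (hp D hD).norm_le _
      rwa [map_sub, h0, sub_zero, one_mul] at h1
    have hd1 : Disjoint A B := hd hA hB hAB
    linarith [key A hA B hB hd1, key B hB A hA hd1.symm]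
  · intro A _
    exact isOpen_lt (by fun_prop) (by fun_prop)
  · intro A hA
    obtain ⟨w, hw⟩ : ∃ w, μ A w ≠ 0 := by
      by_contra! h
      exact hne A hA (ContinuousLinearMap.ext h)
    have h1 : μ A (μ A w) = μ A w := DFunLike.congr_fun (hp A hA).isIdempotentElem.eq w
    refine ⟨μ A w, ?_⟩
    change ‖μ A w - μ A (μ A w)‖ < ‖μ A (μ A w)‖
    rw [h1, sub_self, norm_zero]
    exact norm_pos_iff.2 hw

/-- A maximal disjoint family of atoms in `B` is countable and leaves a null remainder, so countable
additivity passes the vanishing from atoms to `B`. -/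
theorem IsAtomic.apply_mul_eq_zero [TopologicalSpace.SeparableSpace H] {μ : POVM X H}
    (hμ : μ.IsNormalized) (ha : μ.IsAtomic) (hp : ∀ A, μ.IsAtomFor A → IsStarProjection (μ A))
    {B : Set X} (hB : MeasurableSet B) {Z : H →L[ℂ] H}
    (hZ : ∀ A, μ.IsAtomFor A → A ⊆ B → μ A * Z = 0) : μ B * Z = 0 := by
  obtain ⟨S, hS⟩ : ∃ S, Maximal (fun S : Set (Set X) =>
      (∀ A ∈ S, μ.IsAtomFor A ∧ A ⊆ B) ∧ S.PairwiseDisjoint id) S := by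
    refine zorn_subset _ fun C hC hch => ⟨⋃₀ C, ⟨?_, ?_⟩, fun s hs => Set.subset_sUnion_of_mem hs⟩
    · rintro A ⟨s, hs, hA⟩
      exact (hC hs).1 A hA
    · exact (Set.pairwiseDisjoint_sUnion hch.directedOn).2 fun s hs => (hC hs).2
  have hat := hS.prop.1
  have hd := hS.prop.2
  have hm : ∀ A ∈ S, MeasurableSet A := fun A hA => (hat A hA).1.1
  have hcount : S.Countable := hμ.countable_of_pairwiseDisjoint hd hm
    (fun A hA => (hat A hA).1.2.1) (fun A hA => hp A (hat A hA).1)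
  have : Countable S := hcount.to_subtype
  have hd' : Pairwise (Function.onFun Disjoint fun A : S => (A : Set X)) := fun A A' h =>
    hd A.2 A'.2 (Subtype.coe_ne_coe.2 h)
  have hUm : MeasurableSet (⋃ A : S, (A : Set X)) := .iUnion fun A => hm A A.2
  have hUB : (⋃ A : S, (A : Set X)) ⊆ B := Set.iUnion_subset fun A => (hat A A.2).2
  have hrest : μ (B ∩ (⋃ A : S, (A : Set X))ᶜ) = 0 := by
    by_contra hne
    obtain ⟨D, hDB, hD⟩ := ha _ (hB.inter hUm.compl) hne
    have hDd : ∀ A ∈ S, Disjoint D A := fun A hA => Set.disjoint_left.2 fun x hx hxA =>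
      (hDB hx).2 (Set.mem_iUnion.2 ⟨⟨A, hA⟩, hxA⟩)
    have hDS : D ∈ S := by
      refine hS.le_of_ge (y := insert D S) ⟨?_, ?_⟩ (Set.subset_insert _ _) (Set.mem_insert _ _)
      · rintro A (rfl | hA)
        · exact ⟨hD, hDB.trans Set.inter_subset_left⟩
        · exact hat A hA
      · exact hd.insert fun A hA _ => hDd A hA
    -- By maximality `D` belongs to the family, yet it is disjoint from every member, itself
    -- included.
    have h0 : D = ∅ := disjoint_self.1 (hDd D hDS)
    exact hD.2.1 (by rw [h0, apply_empty])
  rw [← μ.apply_inter_add_inter_compl hUm hB, hrest, add_zero, Set.inter_eq_right.2 hUB]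
  exact μ.apply_iUnion_mul_eq_zero (ι := S) (fun A => hm A A.2) hd' fun A =>
    hZ A (hat A A.2).1 (hat A A.2).2

/-- Atomic C*-extreme POVMs are spectral. -/
theorem IsCStarExtreme.isSpectral_of_isAtomic [TopologicalSpace.SeparableSpace H] {μ : POVM X H}
    (hμ : μ.IsCStarExtreme) (ha : μ.IsAtomic) : μ.IsSpectral := by
  have hp : ∀ A, μ.IsAtomFor A → IsStarProjection (μ A) :=
    fun A hA => hμ.isStarProjection_of_isAtomFor hA
  refine ⟨fun B hB => ⟨?_, IsSelfAdjoint.of_nonneg (μ.nonneg hB)⟩, hμ.1⟩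
  have h1 : μ B * μ Bᶜ = 0 := by
    refine ha.apply_mul_eq_zero hμ.1 hp hB fun A hA hAB => ?_
    have h := hμ.1.mul_eq_zero_of_disjoint hA.1 hB.compl
      (Set.disjoint_compl_right_iff_subset.2 hAB) (hp A hA)
    have h' := congrArg star h
    rwa [star_mul, star_zero, μ.star_apply hA.1, μ.star_apply hB.compl] at h'
  have hc : μ Bᶜ = 1 - μ B := by rw [← hμ.1, ← μ.apply_add_compl hB, add_sub_cancel_left]
  rw [hc, mul_sub, mul_one, sub_eq_zero] at h1
  exact h1.symm

/-! ### Countable spaces and the theorem. -/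

/-- Every POVM on a countable measurable space is atomic. -/
theorem isAtomic_of_countable [Countable X] (μ : POVM X H) : μ.IsAtomic := by
  intro A hA hne
  by_contra! hno
  -- Singletons need not be measurable, so the least measurable set around `x` replaces `{x}`;
  -- countability of `X` makes it measurable.
  have hnull : ∀ x ∈ A, μ (measurableAtom x) = 0 := by
    intro x hx
    by_contra h
    refine hno _ (measurableAtom_subset hA hx) ⟨.measurableAtom_of_countable x, h, ?_⟩
    intro B hB hBx
    rcases B.eq_empty_or_nonempty with rfl | ⟨y, hy⟩
    · exact Or.inl μ.apply_empty
    · right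
      rw [hBx.antisymm]
      rw [← measurableAtom_eq_of_mem (hBx hy)]
      exact measurableAtom_subset hB hy
  have hcover : (⋃ B : measurableAtom '' A, (B : Set X)) = A := by
    rw [← Set.sUnion_eq_iUnion, Set.sUnion_image]
    exact (Set.iUnion₂_subset fun x hx => measurableAtom_subset hA hx).antisymm fun x hx =>
      Set.mem_biUnion hx (mem_measurableAtom_self x)
  have : Countable (measurableAtom '' A) := (A.to_countable.image _).to_subtype
  have h0 : μ (⋃ B : measurableAtom '' A, (B : Set X)) * 1 = 0 := by
    refine μ.apply_iUnion_mul_eq_zero (ι := measurableAtom '' A) ?_ ?_ ?_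
    · rintro ⟨_, x, -, rfl⟩
      exact .measurableAtom_of_countable x
    · rintro ⟨_, x, hx, rfl⟩ ⟨_, y, hy, rfl⟩ hxy
      refine disjoint_measurableAtom_of_notMem fun h => hxy (Subtype.ext ?_)
      exact measurableAtom_eq_of_mem h
    · rintro ⟨_, x, hx, rfl⟩
      rw [mul_one]
      exact hnull x hx
  rw [hcover, mul_one] at h0
  exact hne h0

end POVM

theorem mainTheorem2 {X : Type*} [MeasurableSpace X] {H : Type*} [NormedAddCommGroup H]
    [InnerProductSpace ℂ H] [CompleteSpace H] [TopologicalSpace.SeparableSpace H] :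
    (∀ μ : POVM X H, μ.IsNormalized → μ.IsAtomic → (μ.IsCStarExtreme ↔ μ.IsSpectral)) ∧
    (Countable X → ∀ μ : POVM X H, μ.IsCStarExtreme → μ.IsSpectral) :=
  ⟨fun _ _ ha => ⟨fun h => h.isSpectral_of_isAtomic ha, fun h => h.isCStarExtreme⟩,
    fun _ μ h => h.isSpectral_of_isAtomic μ.isAtomic_of_countable⟩
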